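/- Let $K$ be a field. A functor of $\mathcal K$-modules is a covariant functor $\mathbb M$ from the category of commutative $K$-algebras to abelian groups together with a functorial structure of $S$-module on $\mathbb M(S)$ for every commutative $K$-algebra $S$; morphisms are the natural families of $S$-linear maps. Let $\mathcal K$ be the functor $\mathcal K(S)=S$, and for a commutative $K$-algebra $S$ let $\mathbb M_{|S}$ be the restriction of $\mathbb M$ to commutative $S$-algebras. The dual $\mathbb M^*$ is the functor of $\mathcal K$-modules $\mathbb M^*(S):=\operatorname{Hom}_{\mathcal S}(\mathbb M_{|S},\mathcal K_{|S})$; it is well defined if all these collections are sets. $\mathbb M$ is called reflexive if $\mathbb M^*$ is well defined and the natural morphism $\mathbb M\to\mathbb M^{**}$, which sends $m\in\mathbb M(S)$ to the evaluation $w\mapsto w_T(m_T)$ for commutative $S$-algebras $T$ and $w\in\mathbb M^*(T)$ (with $m_T$ the image of $m$ in $\mathbb M(T)$), is an isomorphism. For a $K$-vector space $V$ let $\mathcal V$ be the functor of $\mathcal K$-modules $\mathcal V(S):=V\otimes_K S$. Proposition. Let $I$ be a totally ordered set and let $\{f_{ij}\colon M_i\to M_j\}_{i\ge j\in I}$ be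 an inverse system of $K$-vector spaces and $K$-linear maps ($f_{ii}=\mathrm{id}$ and $f_{jk}\circ f_{ij}=f_{ik}$ for $i\ge j\ge k$). Then the functor of $\mathcal K$-modules $\varprojlim_{i\in I}\mathcal M_i$, given by $S\mapsto\varprojlim_{i\in I}(M_i\otimes_K S)$, is reflexive. -/

import Mathlib

open scoped TensorProduct

universe u w w'

/-- A functor of `𝓡`-modules: a covariant functor `S ↦ M(S)` on the category of commutative
`R`-algebras, with an `S`-module structure on each `M(S)`, functorial in `S`; that is, each
`R`-algebra morphism `f : S → T` acts by an additive map `M(S) → M(T)` that is semilinear along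
`f`. The values may live in any universe `w`. -/
structure FunctorOfModules (R : Type u) [CommRing R] where
  obj : ∀ (S : Type u) [CommRing S] [Algebra R S], Type w
  [addCommGroup : ∀ (S : Type u) [CommRing S] [Algebra R S], AddCommGroup (obj S)]
  [module : ∀ (S : Type u) [CommRing S] [Algebra R S], Module S (obj S)]
  map : ∀ {S T : Type u} [CommRing S] [Algebra R S] [CommRing T] [Algebra R T]
    (f : S →ₐ[R] T), obj S →ₛₗ[(f : S →+* T)] obj T
  map_id : ∀ {S : Type u} [CommRing S] [Algebra R S] (m : obj S), map (AlgHom.id R S) m = m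
  map_comp : ∀ {S T U : Type u} [CommRing S] [Algebra R S] [CommRing T] [Algebra R T]
    [CommRing U] [Algebra R U] (g : T →ₐ[R] U) (f : S →ₐ[R] T) (m : obj S),
    map (g.comp f) m = map g (map f m)

namespace FunctorOfModules

attribute [instance] FunctorOfModules.addCommGroup FunctorOfModules.module

variable {R : Type u} [CommRing R]

/-- Morphisms of functors of `𝓡`-modules: natural families of `S`-linear maps. -/
@[ext]
structure Hom (M : FunctorOfModules.{u, w} R) (N : FunctorOfModules.{u, w'} R) where
  app : ∀ (S : Type u) [CommRing S] [Algebra R S], M.obj S →ₗ[S] N.obj S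
  naturality : ∀ {S T : Type u} [CommRing S] [Algebra R S] [CommRing T] [Algebra R T]
    (f : S →ₐ[R] T) (m : M.obj S), app T (M.map f m) = N.map f (app S m)

/-- The functor `𝓡`, with `𝓡(S) = S`. -/
def base (R : Type u) [CommRing R] : FunctorOfModules.{u, u} R where
  obj S _ _ := S
  addCommGroup S _ _ := inferInstanceAs (AddCommGroup S)
  module S _ _ := inferInstanceAs (Module S S)
  map f := { toFun := f, map_add' := map_add f, map_smul' := fun a b => by simp }
  map_id _ := rfl
  map_comp _ _ _ := rfl

/-- The `S`-morphisms `M|_S → N|_S` between the restrictions of `M` and `N` to the category of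
commutative `S`-algebras. A commutative `S`-algebra is given as a commutative `R`-algebra `T`
with a morphism of `R`-algebras `φ : S → T`; a morphism of `S`-algebras `(T, φ) → (U, ψ)` is a
morphism of `R`-algebras `g : T → U` with `g ∘ φ = ψ`. -/
@[ext]
structure HomOver (M : FunctorOfModules.{u, w} R) (N : FunctorOfModules.{u, w'} R)
    (S : Type u) [CommRing S] [Algebra R S] where
  app : ∀ (T : Type u) [CommRing T] [Algebra R T] (_ : S →ₐ[R] T), M.obj T →ₗ[T] N.obj T
  naturality : ∀ {T U : Type u} [CommRing T] [Algebra R T] [CommRing U] [Algebra R U]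
    (φ : S →ₐ[R] T) (g : T →ₐ[R] U) (m : M.obj T),
    app U (g.comp φ) (M.map g m) = N.map g (app T φ m)

namespace HomOver

variable {M : FunctorOfModules.{u, w} R} {N : FunctorOfModules.{u, w'} R}
  {S : Type u} [CommRing S] [Algebra R S]

instance : Zero (HomOver M N S) := ⟨⟨fun _ _ _ _ => 0, fun _ _ _ => by simp⟩⟩

instance : Add (HomOver M N S) :=
  ⟨fun a b => ⟨fun T _ _ φ => a.app T φ + b.app T φ, fun φ g m => by
    simp [a.naturality, b.naturality]⟩⟩

instance : Neg (HomOver M N S) :=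
  ⟨fun a => ⟨fun T _ _ φ => -a.app T φ, fun φ g m => by simp [a.naturality]⟩⟩

/-- `s ∈ S` acts on the values over an `S`-algebra `(T, φ)` as `φ(s) ∈ T`. -/
instance : SMul S (HomOver M N S) :=
  ⟨fun s a => ⟨fun T _ _ φ => φ s • a.app T φ, fun φ g m => by
    simp [a.naturality, LinearMap.map_smulₛₗ]⟩⟩

theorem add_app (a b : HomOver M N S) (T : Type u) [CommRing T] [Algebra R T] (φ : S →ₐ[R] T) :
    (a + b).app T φ = a.app T φ + b.app T φ := rfl

theorem zero_app (T : Type u) [CommRing T] [Algebra R T] (φ : S →ₐ[R] T) :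
    (0 : HomOver M N S).app T φ = 0 := rfl

theorem neg_app (a : HomOver M N S) (T : Type u) [CommRing T] [Algebra R T] (φ : S →ₐ[R] T) :
    (-a).app T φ = -a.app T φ := rfl

theorem smul_app (s : S) (a : HomOver M N S) (T : Type u) [CommRing T] [Algebra R T]
    (φ : S →ₐ[R] T) : (s • a).app T φ = φ s • a.app T φ := rfl

theorem ext_app {a b : HomOver M N S}
    (h : ∀ (T : Type u) [CommRing T] [Algebra R T] (φ : S →ₐ[R] T), a.app T φ = b.app T φ) :
    a = b := by
  apply HomOver.ext
  funext T _ _ φ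
  exact h T φ

instance : AddCommGroup (HomOver M N S) where
  add_assoc a b c := ext_app fun T _ _ φ => by simp only [add_app, add_assoc]
  zero_add a := ext_app fun T _ _ φ => by simp only [add_app, zero_app, zero_add]
  add_zero a := ext_app fun T _ _ φ => by simp only [add_app, zero_app, add_zero]
  add_comm a b := ext_app fun T _ _ φ => by simp only [add_app, add_comm]
  neg_add_cancel a := ext_app fun T _ _ φ => by
    simp only [add_app, neg_app, zero_app, neg_add_cancel]
  nsmul := nsmulRec
  zsmul := zsmulRec

instance : Module S (HomOver M N S) where
  one_smul a := ext_app fun T _ _ φ => by simp only [smul_app, map_one, one_smul]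
  mul_smul s t a := ext_app fun T _ _ φ => by simp only [smul_app, map_mul, mul_smul]
  smul_zero s := ext_app fun T _ _ φ => by simp only [smul_app, zero_app, smul_zero]
  smul_add s a b := ext_app fun T _ _ φ => by simp only [smul_app, add_app, smul_add]
  add_smul s t a := ext_app fun T _ _ φ => by simp only [smul_app, add_app, map_add, add_smul]
  zero_smul a := ext_app fun T _ _ φ => by simp only [smul_app, zero_app, map_zero, zero_smul]

end HomOver

/-- The functor of `𝓡`-modules `ℍom_𝓡(M, N)`, with `ℍom_𝓡(M, N)(S) = Hom_𝓢(M|_S, N|_S)`; a morphism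
`f : S → S'` acts by restriction from `S`-algebras to `S'`-algebras. -/
def internalHom (M : FunctorOfModules.{u, w} R) (N : FunctorOfModules.{u, w'} R) :
    FunctorOfModules.{u, max (u + 1) w w'} R where
  obj S _ _ := HomOver M N S
  map f :=
    { toFun := fun a => ⟨fun T _ _ φ => a.app T (φ.comp f), fun φ g m => by
        rw [AlgHom.comp_assoc]; exact a.naturality _ g m⟩
      map_add' := fun _ _ => rfl
      map_smul' := fun _ _ => rfl }
  map_id _ := rfl
  map_comp _ _ _ := rfl

/-- The dual `M^* = ℍom_𝓡(M, 𝓡)`. -/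
def dual (M : FunctorOfModules.{u, w} R) : FunctorOfModules.{u, max (u + 1) w} R :=
  internalHom M (base R)

/-- The natural morphism `M → M^{**}`: an element `m ∈ M(S)` goes to the morphism
`M^*|_S → 𝓢` whose value at `w ∈ M^*(T)`, for an `S`-algebra `(T, φ)`, is `w_T(φ(m)) ∈ T`. -/
def toBidual (M : FunctorOfModules.{u, w} R) : Hom M M.dual.dual where
  app S _ _ :=
    { toFun := fun m =>
        { app := fun T _ _ φ =>
            { toFun := fun a => HomOver.app a T (AlgHom.id R T) (M.map φ m)
              map_add' := fun _ _ => rfl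
              map_smul' := fun _ _ => rfl }
          naturality := fun {T U} _ _ _ _ φ g a => by
            change HomOver.app a U ((AlgHom.id R U).comp g) (M.map (g.comp φ) m) = _
            rw [M.map_comp]
            exact a.naturality (AlgHom.id R T) g (M.map φ m) }
      map_add' := fun m n => HomOver.ext_app fun T _ _ φ => LinearMap.ext fun a => by
        change HomOver.app a T (AlgHom.id R T) (M.map φ (m + n)) =
          HomOver.app a T (AlgHom.id R T) (M.map φ m) +
            HomOver.app a T (AlgHom.id R T) (M.map φ n)
        rw [map_add, map_add]
      map_smul' := fun s m => HomOver.ext_app fun T _ _ φ => LinearMap.ext fun a => by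
        change HomOver.app a T (AlgHom.id R T) (M.map φ (s • m)) =
          φ s • HomOver.app a T (AlgHom.id R T) (M.map φ m)
        rw [LinearMap.map_smulₛₗ, LinearMap.map_smul]
        rfl }
  naturality {S T} _ _ _ _ f m := HomOver.ext_app fun U _ _ φ => LinearMap.ext fun a => by
    change HomOver.app a U (AlgHom.id R U) (M.map φ (M.map f m)) =
      HomOver.app a U (AlgHom.id R U) (M.map (φ.comp f) m)
    rw [M.map_comp]

/-- `M` is reflexive: `M^*` is well defined (its values, which are collections of natural
transformations on a large category, are sets, i.e. small), and the natural morphism `M → M^{**}`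
is an isomorphism. -/
def IsReflexive (M : FunctorOfModules.{u, u} R) : Prop :=
  (∀ (S : Type u) [CommRing S] [Algebra R S], Small.{u} (M.dual.obj S)) ∧
    ∀ (S : Type u) [CommRing S] [Algebra R S], Function.Bijective (M.toBidual.app S)

/-- The quasi-coherent module associated with an `R`-module `V`: the functor `S ↦ S ⊗_R V`. -/
def quasiCoherent (R : Type u) [CommRing R] (V : Type u) [AddCommGroup V] [Module R V] :
    FunctorOfModules.{u, u} R where
  obj S _ _ := S ⊗[R] V
  addCommGroup S _ _ := inferInstanceAs (AddCommGroup (S ⊗[R] V))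
  module S _ _ := inferInstanceAs (Module S (S ⊗[R] V))
  map f :=
    { toFun := f.toLinearMap.rTensor V
      map_add' := fun x y => LinearMap.map_add _ x y
      map_smul' := fun s x => by
        induction x using TensorProduct.induction_on with
        | zero => simp
        | tmul a v => simp [TensorProduct.smul_tmul']
        | add x y hx hy => rw [smul_add, map_add, hx, hy, map_add, smul_add] }
  map_id m := LinearMap.rTensor_id_apply V _ m
  map_comp g f m := LinearMap.rTensor_comp_apply V g.toLinearMap f.toLinearMap m

/-- The morphism of quasi-coherent modules induced by an `R`-linear map. -/
def quasiCoherentMap {V W : Type u} [AddCommGroup V] [Module R V] [AddCommGroup W] [Module R W]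
    (f : V →ₗ[R] W) : Hom (quasiCoherent R V) (quasiCoherent R W) where
  app S _ _ := f.baseChange S
  naturality {S T} _ _ _ _ g m := by
    have h : ∀ x : S ⊗[R] V,
        f.lTensor T (g.toLinearMap.rTensor V x) = g.toLinearMap.rTensor W (f.lTensor S x) :=
      fun x => by
        rw [← LinearMap.comp_apply, ← LinearMap.comp_apply, LinearMap.lTensor_comp_rTensor,
          LinearMap.rTensor_comp_lTensor]
    exact h m

/-- The inverse limit of a family of functors of `𝓡`-modules `F i` along transition morphisms
`F j → F i`, `i ≤ j`, computed objectwise: `(lim F)(S)` consists of the compatible families in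
`∏ i, F i (S)`. -/
def inverseLimit {I : Type u} [Preorder I] (F : I → FunctorOfModules.{u, u} R)
    (t : ∀ ⦃i j : I⦄, i ≤ j → Hom (F j) (F i)) : FunctorOfModules.{u, u} R where
  obj S _ _ :=
    ({ carrier := {x | ∀ ⦃i j : I⦄ (h : i ≤ j), (t h).app S (x j) = x i}
       add_mem' := fun {x y} hx hy i j h => by simp [hx h, hy h]
       zero_mem' := fun i j h => by simp
       smul_mem' := fun s x hx i j h => by simp [hx h] } : Submodule S (∀ i, (F i).obj S))
  map f :=
    { toFun := fun x => ⟨fun i => (F i).map f (x.1 i), fun i j h => by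
        rw [(t h).naturality, x.2 h]⟩
      map_add' := fun x y => Subtype.ext <| funext fun i => map_add ((F i).map f) _ _
      map_smul' := fun s x => Subtype.ext <| funext fun i =>
        LinearMap.map_smulₛₗ ((F i).map f) _ _ }
  map_id x := Subtype.ext <| funext fun i => (F i).map_id _
  map_comp g f x := Subtype.ext <| funext fun i => (F i).map_comp g f _

end FunctorOfModules

/-!
Write `N = lim M i`, and let `F` be the functor `S ↦ lim (S ⊗ M i)`. In coordinates with respect to
a `K`-basis `b` of `S`, an element of `F(S)` is an infinite sum `∑ b a ⊗ v a`, where the family `v` in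
`N` is *summable*: every `M i` sees only finitely many of its members (`exists_eq_formalSum`).

The engine of the proof is `HomOver.exists_functional_generic_eq_sum`: if `y = ∑ t_a y_a` is an
element over `S[t_a : a ∈ A]` whose coefficients are independent variables, then a natural
functional takes at `y` a value that is a polynomial, hence involves finitely many `t_a`, and
setting the other variables to zero shows that this value is the finite sum `∑ t_a w(y_a)`. It is
used twice.

* For functionals `w ∈ F^*(S)` and `y = ∑ t_a ⊗ v a`: `w` is determined by its restriction `N → S`
  (`restrictVec_injective`), and this restriction is nonzero at only finitely many members of each
  summable family (`finite_restrictVec_ne_zero`).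
* For functionals `Φ ∈ F^{**}(S)`, a morphism `p : F → 𝓥` and the generic linear form on `V`: along
  `p`, `Φ` is evaluation at an element of `S ⊗ V` (`exists_eq_liftBaseChange`). Consequently `F` is
  reflexive if it is the limit of morphisms to quasi-coherent modules through which all
  functionals on `F` factor (`isReflexive_of_forall_exists_ofLinear`).

The total order enters through a dichotomy on the cofinality of `I`. If a monotone sequence `s n` is
cofinal, a functional vanishing on no kernel `ker (N → M i)` would be nonzero on all members of some
sequence `v n ∈ ker (N → M (s n))`, which is summable; so every functional factors through some `M i`. If no
sequence is cofinal, countably many nonzero elements of `N` stay nonzero in a common `M i`, so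
summable families are finite and `F` is the quasi-coherent module of `N`.
-/

namespace FunctorOfModules

section CommRing

variable {R : Type u} [CommRing R] {G : FunctorOfModules.{u, w} R}
  {S T U : Type u} [CommRing S] [Algebra R S] [CommRing T] [Algebra R T] [CommRing U] [Algebra R U]

/-! ### Values of functionals at generic elements -/

/-- The component at `(T, φ)` of an element of `G^*(S)`, with values in `T` itself rather than in
the definitionally equal `(base R).obj T`. -/
def HomOver.functional (w : HomOver G (base R) S) (φ : S →ₐ[R] T) : G.obj T →ₗ[T] T :=
  w.app T φ

theorem HomOver.functional_map (w : HomOver G (base R) S) (φ : S →ₐ[R] T) (g : T →ₐ[R] U)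
    (m : G.obj T) : w.functional (g.comp φ) (G.map g m) = g (w.functional φ m) :=
  w.naturality φ g m

theorem HomOver.ext_functional {w₁ w₂ : HomOver G (base R) S}
    (h : ∀ (T : Type u) [CommRing T] [Algebra R T] (φ : S →ₐ[R] T) (m : G.obj T),
      w₁.functional φ m = w₂.functional φ m) : w₁ = w₂ :=
  HomOver.ext_app fun T _ _ φ => LinearMap.ext fun m => h T φ m

theorem HomOver.functional_sub (w₁ w₂ : HomOver G (base R) S) (φ : S →ₐ[R] T) (m : G.obj T) :
    (w₁ - w₂).functional φ m = w₁.functional φ m - w₂.functional φ m := by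
  rw [sub_eq_add_neg, sub_eq_add_neg]
  rfl

/-- The inclusion of constants `S → S[t_a : a ∈ A]`, as a morphism of `R`-algebras. -/
noncomputable def constHom (R S : Type u) [CommRing R] [CommRing S] [Algebra R S] (A : Type u) :
    S →ₐ[R] MvPolynomial A S :=
  (Algebra.ofId S (MvPolynomial A S)).restrictScalars R

@[simp]
theorem constHom_apply (A : Type u) (s : S) : constHom R S A s = MvPolynomial.C s := rfl

/-- The morphism of `R`-algebras `S[t_a : a ∈ A] → T` that is `φ` on `S` and sends `t_a` to
`c a`. -/
noncomputable def evalHom (φ : S →ₐ[R] T) {A : Type u} (c : A → T) : MvPolynomial A S →ₐ[R] T :=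
  { MvPolynomial.eval₂Hom (φ : S →+* T) c with
    commutes' := fun r => by
      change MvPolynomial.eval₂Hom (φ : S →+* T) c (algebraMap R (MvPolynomial A S) r) = _
      rw [IsScalarTower.algebraMap_apply R S (MvPolynomial A S), MvPolynomial.algebraMap_eq,
        MvPolynomial.eval₂Hom_C]
      exact φ.commutes r }

@[simp]
theorem evalHom_X (φ : S →ₐ[R] T) {A : Type u} (c : A → T) (a : A) :
    evalHom φ c (MvPolynomial.X a) = c a :=
  MvPolynomial.eval₂Hom_X' _ _ _

@[simp]
theorem evalHom_C (φ : S →ₐ[R] T) {A : Type u} (c : A → T) (s : S) :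
    evalHom φ c (MvPolynomial.C s) = φ s :=
  MvPolynomial.eval₂Hom_C _ _ _

@[simp]
theorem evalHom_comp_constHom (φ : S →ₐ[R] T) {A : Type u} (c : A → T) :
    (evalHom φ c).comp (constHom R S A) = φ :=
  AlgHom.ext fun s => evalHom_C φ c s

open Classical in
/-- The endomorphism of `S[t_a : a ∈ A]` that sets to zero all variables outside `A₀`. -/
noncomputable def killOutside (R S : Type u) [CommRing R] [CommRing S] [Algebra R S] {A : Type u}
    (A₀ : Finset A) : MvPolynomial A S →ₐ[R] MvPolynomial A S :=
  evalHom (constHom R S A) fun a => if a ∈ A₀ then MvPolynomial.X a else 0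

theorem killOutside_eq_self {A : Type u} {A₀ : Finset A} {P : MvPolynomial A S}
    (h : P.vars ⊆ A₀) : killOutside R S A₀ P = P := by
  classical
  have := MvPolynomial.hom_congr_vars (f₁ := (killOutside R S A₀ : _ →+* MvPolynomial A S))
    (f₂ := RingHom.id _) (p₁ := P) (p₂ := P) ?_ ?_ rfl
  · simpa using this
  · ext1 s
    simp [killOutside]
  · intro a ha _
    simp [killOutside, h ha]

/-- A natural functional `w` takes a finite linear value on a generic element `y = ∑ t_a y_a`,
even when that sum is infinite: the polynomial `w(y)` involves finitely many of the variables, and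
setting the others to zero does not change it. -/
theorem HomOver.exists_functional_generic_eq_sum (w : HomOver G (base R) S) {A : Type u}
    (y : G.obj (MvPolynomial A S)) (y' : A → G.obj S)
    (hy : ∀ A₀ : Finset A, G.map (killOutside R S A₀) y =
      ∑ a ∈ A₀, (MvPolynomial.X a : MvPolynomial A S) • G.map (constHom R S A) (y' a)) :
    ∃ A₀ : Finset A, (∀ a ∉ A₀, w.functional (AlgHom.id R S) (y' a) = 0) ∧
      w.functional (constHom R S A) y =
        ∑ a ∈ A₀, MvPolynomial.X a * MvPolynomial.C (w.functional (AlgHom.id R S) (y' a)) := by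
  classical
  have key : ∀ A₀ : Finset A, (w.functional (constHom R S A) y).vars ⊆ A₀ →
      w.functional (constHom R S A) y =
        ∑ a ∈ A₀, MvPolynomial.X a * MvPolynomial.C (w.functional (AlgHom.id R S) (y' a)) := by
    intro A₀ h
    have hcomp : (killOutside R S A₀).comp (constHom R S A) = constHom R S A :=
      evalHom_comp_constHom _ _
    have h₁ := w.functional_map (constHom R S A) (killOutside R S A₀) y
    rw [hcomp, killOutside_eq_self h, hy, map_sum] at h₁
    rw [← h₁]
    refine Finset.sum_congr rfl fun a _ => ?_
    rw [map_smul, smul_eq_mul]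
    exact congrArg _ (w.functional_map (AlgHom.id R S) (constHom R S A) (y' a))
  refine ⟨(w.functional (constHom R S A) y).vars, fun a ha => ?_, key _ subset_rfl⟩
  have h := key (insert a (w.functional (constHom R S A) y).vars) (Finset.subset_insert _ _)
  rw [Finset.sum_insert ha, ← key _ subset_rfl, right_eq_add] at h
  -- the coefficient of `t_a` in `t_a * w(y_a)`
  have h' := congrArg (MvPolynomial.coeff (Finsupp.single a 1)) h
  rw [mul_comm, MvPolynomial.coeff_C_mul, MvPolynomial.coeff_X, if_pos rfl, mul_one,
    MvPolynomial.coeff_zero] at h'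
  exact h'

end CommRing

/-! ### Functionals induced by linear forms -/

section Field

variable {K : Type u} [Field K] {F : FunctorOfModules.{u, u} K}
  {S T U : Type u} [CommRing S] [Algebra K S] [CommRing T] [Algebra K T] [CommRing U] [Algebra K U]
  {V : Type u} [AddCommGroup V] [Module K V]

/-- The component at `S` of a morphism to a quasi-coherent module, with values in `S ⊗ V` itself. -/
def Hom.toTensor (p : Hom F (quasiCoherent K V)) (S : Type u) [CommRing S] [Algebra K S] :
    F.obj S →ₗ[S] S ⊗[K] V :=
  p.app S

theorem Hom.toTensor_map (p : Hom F (quasiCoherent K V)) (g : S →ₐ[K] T) (m : F.obj S) :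
    p.toTensor T (F.map g m) = g.toLinearMap.rTensor V (p.toTensor S m) :=
  p.naturality g m

theorem liftBaseChange_rTensor (ℓ : V →ₗ[K] T) (g : T →ₐ[K] U) (x : T ⊗[K] V) :
    (g.toLinearMap ∘ₗ ℓ).liftBaseChange U (g.toLinearMap.rTensor V x) =
      g (ℓ.liftBaseChange T x) := by
  induction x with
  | zero => simp
  | tmul t v => simp
  | add x y hx hy => simp only [map_add, hx, hy]

/-- The element of `F^*(S)` that is the composite of `p : F → 𝓥` with the element of `𝓥^*(S)`
given by a linear map `V → S`. -/
noncomputable def ofLinear (p : Hom F (quasiCoherent K V)) (ℓ : V →ₗ[K] S) :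
    HomOver F (base K) S where
  app T _ _ φ := (φ.toLinearMap ∘ₗ ℓ).liftBaseChange T ∘ₗ p.toTensor T
  naturality φ g m := by
    change ((g.comp φ).toLinearMap ∘ₗ ℓ).liftBaseChange _ (p.toTensor _ (F.map g m)) =
      g ((φ.toLinearMap ∘ₗ ℓ).liftBaseChange _ (p.toTensor _ m))
    rw [p.toTensor_map]
    exact liftBaseChange_rTensor (φ.toLinearMap ∘ₗ ℓ) g _

theorem functional_ofLinear (p : Hom F (quasiCoherent K V)) (ℓ : V →ₗ[K] S) (φ : S →ₐ[K] T)
    (m : F.obj T) : (ofLinear p ℓ).functional φ m =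
      (φ.toLinearMap ∘ₗ ℓ).liftBaseChange T (p.toTensor T m) := rfl

theorem dual_map_ofLinear (p : Hom F (quasiCoherent K V)) (ℓ : V →ₗ[K] S) (g : S →ₐ[K] T) :
    F.dual.map g (ofLinear p ℓ) = ofLinear p (g.toLinearMap ∘ₗ ℓ) := rfl

/-- `ofLinear p` as a linear map, for the `S`-module structure of `F^*(S)`. -/
noncomputable def ofLinearₗ (p : Hom F (quasiCoherent K V)) (S : Type u) [CommRing S]
    [Algebra K S] :
    (V →ₗ[K] S) →ₗ[S] F.dual.obj S where
  toFun ℓ := ofLinear p ℓ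
  map_add' ℓ ℓ' := HomOver.ext_functional fun T _ _ φ m => by
    change _ = (ofLinear p ℓ).functional φ m + (ofLinear p ℓ').functional φ m
    simp only [functional_ofLinear]
    rw [LinearMap.comp_add, ← LinearMap.add_apply]
    congr 1
    ext
    simp
  map_smul' s ℓ := HomOver.ext_functional fun T _ _ φ m => by
    change _ = φ s • (ofLinear p ℓ).functional φ m
    simp only [functional_ofLinear]
    rw [← LinearMap.smul_apply]
    congr 1
    ext
    simp

/-- Linear forms with values in `S` separate the points of `S ⊗ V`, because `V` is free. -/
theorem eq_zero_of_liftBaseChange_eq_zero {x : S ⊗[K] V}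
    (h : ∀ ℓ : V →ₗ[K] S, ℓ.liftBaseChange S x = 0) : x = 0 := by
  let b := Module.Basis.ofVectorSpace K V
  refine (b.baseChange S).ext_elem fun i => ?_
  have hc : ((Algebra.linearMap K S ∘ₗ b.coord i).liftBaseChange S) =
      (b.baseChange S).coord i := by
    ext v
    simp [Algebra.algebraMap_eq_smul_one]
  have := h (Algebra.linearMap K S ∘ₗ b.coord i)
  rw [hc] at this
  simpa using this

/-- The quasi-coherent module `𝓥` is reflexive, in a relative form: along `p : F → 𝓥`, every
`Φ ∈ F^{**}(S)` is evaluation at an element `x` of `S ⊗ V`. The coordinates of `x` in a basis of `V`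
are the values of `Φ` at the coordinate forms; they are finitely many because `Φ` takes a
polynomial value at the generic linear form. -/
theorem exists_eq_liftBaseChange (p : Hom F (quasiCoherent K V))
    (Φ : HomOver F.dual (base K) S) :
    ∃ x : S ⊗[K] V, ∀ (T : Type u) [CommRing T] [Algebra K T] (φ : S →ₐ[K] T) (ℓ : V →ₗ[K] T),
      Φ.functional φ (ofLinear p ℓ) =
        ℓ.liftBaseChange T (φ.toLinearMap.rTensor V x) := by
  classical
  let b := Module.Basis.ofVectorSpace K V
  let A := Module.Basis.ofVectorSpaceIndex K V
  let gen : V →ₗ[K] MvPolynomial A S := b.constr K fun a => MvPolynomial.X a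
  let coord : A → V →ₗ[K] S := fun a => Algebra.linearMap K S ∘ₗ b.coord a
  obtain ⟨A₀, -, hA₀⟩ := Φ.exists_functional_generic_eq_sum (A := A) (ofLinear p gen)
    (fun a => ofLinear p (coord a)) (by
      intro A₀
      have e : (killOutside K S A₀).toLinearMap ∘ₗ gen = ∑ a ∈ A₀,
          (MvPolynomial.X a : MvPolynomial A S) • ((constHom K S A).toLinearMap ∘ₗ coord a) := by
        refine b.ext fun a => ?_
        simp [gen, coord, killOutside, LinearMap.sum_apply, Finsupp.single_apply,
          apply_ite (algebraMap K S)]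
      have h := congrArg (ofLinearₗ p (MvPolynomial A S)) e
      rw [map_sum] at h
      refine h.trans (Finset.sum_congr rfl fun a _ => ?_)
      exact map_smul _ _ _)
  refine ⟨∑ a ∈ A₀, Φ.functional (AlgHom.id K S) (ofLinear p (coord a)) ⊗ₜ b a,
    fun T _ _ φ ℓ => ?_⟩
  have hℓ : ℓ = (evalHom φ fun a => ℓ (b a)).toLinearMap ∘ₗ gen :=
    b.ext fun a => by simp [gen]
  have h := Φ.functional_map (constHom K S A) (evalHom φ fun a => ℓ (b a)) (ofLinear p gen)
  rw [evalHom_comp_constHom, hA₀, dual_map_ofLinear, ← hℓ] at h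
  rw [h]
  simp [mul_comm]

theorem functional_toBidual (x : F.obj S) (φ : S →ₐ[K] T) (w : HomOver F (base K) T) :
    HomOver.functional (G := F.dual) (F.toBidual.app S x) φ w =
      w.functional (AlgHom.id K T) (F.map φ x) := rfl

/-- A criterion for reflexivity. Let `F` be the limit of its morphisms `p j` to quasi-coherent
modules, in the sense of `h_inj` and `h_lim`. If every functional on `F` is pulled back along some
`p j`, then `F` is reflexive. -/
theorem isReflexive_of_forall_exists_ofLinear {J : Type u} {V : J → Type u}
    [∀ j, AddCommGroup (V j)] [∀ j, Module K (V j)] (p : ∀ j, Hom F (quasiCoherent K (V j)))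
    (h_inj : ∀ (S : Type u) [CommRing S] [Algebra K S] (x : F.obj S),
      (∀ j, (p j).toTensor S x = 0) → x = 0)
    (h_lim : ∀ (S : Type u) [CommRing S] [Algebra K S] (x : ∀ j, S ⊗[K] V j),
      (∀ (j k : J) (ℓ : V j →ₗ[K] S) (ℓ' : V k →ₗ[K] S), ofLinear (p j) ℓ = ofLinear (p k) ℓ' →
        ℓ.liftBaseChange S (x j) = ℓ'.liftBaseChange S (x k)) →
      ∃ y : F.obj S, ∀ j, (p j).toTensor S y = x j)
    (h_fac : ∀ (S : Type u) [CommRing S] [Algebra K S] (w : HomOver F (base K) S),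
      ∃ (j : J) (ℓ : V j →ₗ[K] S), w = ofLinear (p j) ℓ) :
    F.IsReflexive := by
  refine ⟨fun S _ _ => ?_, fun S _ _ => ⟨?_, fun Φ => ?_⟩⟩
  · refine small_of_surjective (α := Σ j, (V j →ₗ[K] S)) (f := fun q => ofLinear (p q.1) q.2) ?_
    intro w
    obtain ⟨j, ℓ, h⟩ := h_fac S w
    exact ⟨⟨j, ℓ⟩, h.symm⟩
  · rw [injective_iff_map_eq_zero]
    intro x hx
    refine h_inj S x fun j => eq_zero_of_liftBaseChange_eq_zero fun ℓ => ?_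
    have h := functional_toBidual x (AlgHom.id K S) (ofLinear (p j) ℓ)
    rw [hx, F.map_id, functional_ofLinear] at h
    exact h.symm
  · choose x hx using fun j => exists_eq_liftBaseChange (p j) Φ
    have hx' : ∀ j (ℓ : V j →ₗ[K] S), HomOver.functional (G := F.dual) Φ (AlgHom.id K S)
        (ofLinear (p j) ℓ) = ℓ.liftBaseChange S (x j) := fun j ℓ => by
      rw [hx]
      exact congrArg _ (LinearMap.rTensor_id_apply _ _ _)
    obtain ⟨y, hy⟩ := h_lim S x fun j k ℓ ℓ' h => by rw [← hx', ← hx', h]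
    refine ⟨y, HomOver.ext_functional (G := F.dual) fun T _ _ φ w => ?_⟩
    obtain ⟨j, ℓ, rfl⟩ := h_fac T w
    rw [functional_toBidual, functional_ofLinear, (p j).toTensor_map, hy, hx]
    rfl

end Field

/-! ### Elements of the limit as infinite sums -/

section Limit

variable {K : Type u} [Field K] {I : Type u} [LinearOrder I]
  {M : I → Type u} [∀ i, AddCommGroup (M i)] [∀ i, Module K (M i)]
  (f : ∀ ⦃i j : I⦄, i ≤ j → M j →ₗ[K] M i)
  {S T : Type u} [CommRing S] [Algebra K S] [CommRing T] [Algebra K T]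

/-- The functor `S ↦ lim (S ⊗ M i)`. -/
abbrev limFunctor : FunctorOfModules.{u, u} K :=
  inverseLimit (fun i => quasiCoherent K (M i)) (fun _ _ h => quasiCoherentMap (f h))

/-- The projection `lim 𝓜 i → 𝓜 i`. -/
def limProj (i : I) : Hom (limFunctor f) (quasiCoherent K (M i)) where
  app _ _ _ :=
    { toFun := fun x => x.1 i
      map_add' := fun _ _ => rfl
      map_smul' := fun _ _ => rfl }
  naturality _ _ := rfl

variable {f}

theorem limFunctor_ext {x y : (limFunctor f).obj S}
    (h : ∀ i, (limProj f i).toTensor S x = (limProj f i).toTensor S y) : x = y :=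
  Subtype.ext (funext h)

theorem baseChange_limProj {i j : I} (h : i ≤ j) (x : (limFunctor f).obj S) :
    (f h).baseChange S ((limProj f j).toTensor S x) = (limProj f i).toTensor S x :=
  x.2 h

variable (f) in
/-- The element of `lim (S ⊗ M i)` given by a compatible family. -/
def limMk (x : ∀ i, S ⊗[K] M i)
    (hx : ∀ ⦃i j : I⦄ (h : i ≤ j), (f h).baseChange S (x j) = x i) : (limFunctor f).obj S :=
  ⟨x, hx⟩

@[simp]
theorem limProj_limMk (x : ∀ i, S ⊗[K] M i)
    (hx : ∀ ⦃i j : I⦄ (h : i ≤ j), (f h).baseChange S (x j) = x i) (i : I) :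
    (limProj f i).toTensor S (limMk f x hx) = x i := rfl

variable (f) in
/-- The vector space `lim M i`. -/
def vecLimit : Submodule K (∀ i, M i) where
  carrier := {v | ∀ ⦃i j : I⦄ (h : i ≤ j), f h (v j) = v i}
  add_mem' hx hy i j h := by simp [hx h, hy h]
  zero_mem' i j h := by simp
  smul_mem' c x hx i j h := by simp [hx h]

variable (f) in
/-- The projection `lim M i → M i`. -/
def vecProj (i : I) : vecLimit f →ₗ[K] M i := LinearMap.proj i ∘ₗ (vecLimit f).subtype

theorem map_vecProj {i j : I} (h : i ≤ j) (v : vecLimit f) : f h (vecProj f j v) = vecProj f i v :=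
  v.2 h

theorem vecLimit_ext {v v' : vecLimit f} (h : ∀ i, vecProj f i v = vecProj f i v') : v = v' :=
  Subtype.ext (funext h)

variable (S) in
/-- The canonical map `S ⊗ lim M i → lim (S ⊗ M i)`. -/
noncomputable def tensorToLim : S ⊗[K] vecLimit f →ₗ[S] (limFunctor f).obj S where
  toFun x := limMk f (fun i => (vecProj f i).baseChange S x) fun i j h => by
    rw [← LinearMap.comp_apply, ← LinearMap.baseChange_comp]
    congr 2
    exact LinearMap.ext (map_vecProj h)
  map_add' x y := limFunctor_ext fun i => by
    rw [map_add]
    simp only [limProj_limMk, map_add]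
  map_smul' s x := limFunctor_ext fun i => by
    rw [map_smul]
    simp only [limProj_limMk, map_smul, RingHom.id_apply]

theorem limProj_tensorToLim (i : I) (x : S ⊗[K] vecLimit f) :
    (limProj f i).toTensor S (tensorToLim S x) = (vecProj f i).baseChange S x := rfl

theorem map_tensorToLim (g : S →ₐ[K] T) (x : S ⊗[K] vecLimit f) :
    (limFunctor f).map g (tensorToLim S x) =
      tensorToLim T (g.toLinearMap.rTensor (vecLimit f) x) := by
  refine limFunctor_ext fun i => ?_
  rw [Hom.toTensor_map, limProj_tensorToLim, limProj_tensorToLim]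
  induction x with
  | zero => simp
  | tmul s v => simp
  | add x y hx hy => simp only [map_add, hx, hy]

/-- Each `M i` sees only finitely many members of the family `v`, so that sums with arbitrary
coefficients converge in the limit. -/
def IsSummableFamily {A : Type u} (v : A → vecLimit f) : Prop :=
  ∀ i, {a | vecProj f i (v a) ≠ 0}.Finite

theorem IsSummableFamily.finite_support {A : Type u} {v : A → vecLimit f}
    (hv : IsSummableFamily v) (c : A → S) (i : I) :
    (Function.support fun a => c a ⊗ₜ[K] vecProj f i (v a)).Finite :=
  (hv i).subset fun a ha h0 => ha (by simp [h0])

/-- The infinite sum `∑ c a ⊗ v a` in `lim (S ⊗ M i)`. -/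
noncomputable def formalSum {A : Type u} {v : A → vecLimit f} (hv : IsSummableFamily v)
    (c : A → S) : (limFunctor f).obj S :=
  limMk f (fun i => ∑ᶠ a, c a ⊗ₜ[K] vecProj f i (v a)) fun i j h => by
    rw [map_finsum _ (hv.finite_support c j)]
    simp [map_vecProj]

theorem limProj_formalSum {A : Type u} {v : A → vecLimit f} (hv : IsSummableFamily v)
    (c : A → S) (i : I) : (limProj f i).toTensor S (formalSum hv c) =
      ∑ᶠ a, c a ⊗ₜ[K] vecProj f i (v a) := rfl

theorem map_formalSum {A : Type u} {v : A → vecLimit f} (hv : IsSummableFamily v)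
    (c : A → S) (g : S →ₐ[K] T) :
    (limFunctor f).map g (formalSum hv c) = formalSum hv fun a => g (c a) := by
  refine limFunctor_ext fun i => ?_
  rw [Hom.toTensor_map, limProj_formalSum, limProj_formalSum,
    map_finsum _ (hv.finite_support c i)]
  simp

theorem formalSum_eq_tensorToLim_sum {A : Type u} {v : A → vecLimit f} (hv : IsSummableFamily v)
    (c : A → S) (A₀ : Finset A) (h : ∀ a ∉ A₀, c a ⊗ₜ[K] v a = 0) :
    formalSum hv c = tensorToLim S (∑ a ∈ A₀, c a ⊗ₜ v a) := by
  refine limFunctor_ext fun i => ?_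
  rw [limProj_formalSum, limProj_tensorToLim, map_sum]
  refine finsum_eq_sum_of_support_subset _ fun a ha => ?_
  by_contra hA
  refine ha ?_
  simpa using congrArg ((vecProj f i).baseChange S) (h a hA)

theorem equivFinsuppOfBasisLeft_baseChange {A : Type u} [DecidableEq A] (b : Module.Basis A K S)
    {V W : Type u} [AddCommGroup V] [Module K V] [AddCommGroup W] [Module K W]
    (g : V →ₗ[K] W) (x : S ⊗[K] V) (a : A) :
    TensorProduct.equivFinsuppOfBasisLeft b (g.baseChange S x) a =
      g (TensorProduct.equivFinsuppOfBasisLeft b x a) := by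
  induction x with
  | zero => simp
  | tmul s v => simp
  | add x y hx hy => simp only [map_add, Finsupp.add_apply, hx, hy]

/-- Every element of `lim (S ⊗ M i)` is an infinite sum `∑ b a ⊗ v a` over a `K`-basis `b` of `S`.
-/
theorem exists_eq_formalSum (x : (limFunctor f).obj S) :
    ∃ (v : Module.Basis.ofVectorSpaceIndex K S → vecLimit f) (hv : IsSummableFamily v),
      x = formalSum hv (Module.Basis.ofVectorSpace K S) := by
  classical
  let b := Module.Basis.ofVectorSpace K S
  let e := fun i => TensorProduct.equivFinsuppOfBasisLeft (N := M i) b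
  let v : Module.Basis.ofVectorSpaceIndex K S → vecLimit f := fun a =>
    ⟨fun i => e i ((limProj f i).toTensor S x) a, fun i j h => by
      change f h (e j ((limProj f j).toTensor S x) a) = e i ((limProj f i).toTensor S x) a
      rw [← baseChange_limProj h]
      exact (equivFinsuppOfBasisLeft_baseChange b (f h) _ a).symm⟩
  have hv : IsSummableFamily v := fun i => (e i ((limProj f i).toTensor S x)).hasFiniteSupport
  refine ⟨v, hv, limFunctor_ext fun i => ?_⟩
  rw [limProj_formalSum, ← (e i).symm_apply_apply ((limProj f i).toTensor S x),
    TensorProduct.equivFinsuppOfBasisLeft_symm_apply]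
  refine (finsum_eq_sum_of_support_subset _ fun a ha => ?_).symm
  rw [Finset.mem_coe, Finsupp.mem_support_iff]
  intro h0
  refine ha ?_
  change b a ⊗ₜ[K] (e i ((limProj f i).toTensor S x) a) = 0
  rw [h0, TensorProduct.tmul_zero]

theorem tensorToLim_injective : Function.Injective (tensorToLim (f := f) S) := by
  classical
  rw [injective_iff_map_eq_zero]
  intro x hx
  let b := Module.Basis.ofVectorSpace K S
  refine (TensorProduct.equivFinsuppOfBasisLeft b).map_eq_zero_iff.1 ?_
  refine Finsupp.ext fun a => vecLimit_ext fun i => ?_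
  rw [← equivFinsuppOfBasisLeft_baseChange, ← limProj_tensorToLim, hx]
  simp

/-! ### Functionals on the limit -/

theorem map_killOutside_formalSum {A : Type u} {v : A → vecLimit f} (hv : IsSummableFamily v)
    (A₀ : Finset A) :
    (limFunctor f).map (killOutside K S A₀) (formalSum hv MvPolynomial.X) =
      ∑ a ∈ A₀, (MvPolynomial.X a : MvPolynomial A S) •
        (limFunctor f).map (constHom K S A) (tensorToLim S (1 ⊗ₜ v a)) := by
  classical
  rw [map_formalSum, formalSum_eq_tensorToLim_sum hv _ A₀, map_sum]
  · refine Finset.sum_congr rfl fun a ha => ?_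
    rw [map_tensorToLim, ← map_smul]
    simp [killOutside, ha, TensorProduct.smul_tmul']
  · intro a ha
    simp [killOutside, ha]

/-- The restriction to `lim M i` of a functional on `lim 𝓜 i`. -/
noncomputable def restrictVec (w : HomOver (limFunctor f) (base K) S) : vecLimit f →ₗ[K] S :=
  (w.functional (AlgHom.id K S) ∘ₗ tensorToLim S).restrictScalars K ∘ₗ
    TensorProduct.mk K S (vecLimit f) 1

theorem restrictVec_apply (w : HomOver (limFunctor f) (base K) S) (v : vecLimit f) :
    restrictVec w v = w.functional (AlgHom.id K S) (tensorToLim S (1 ⊗ₜ v)) := rfl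

/-- A functional on the limit is nonzero at only finitely many members of a summable family:
evaluate it at the generic sum `∑ t_a ⊗ v a`. -/
theorem finite_restrictVec_ne_zero (w : HomOver (limFunctor f) (base K) S) {A : Type u}
    {v : A → vecLimit f} (hv : IsSummableFamily v) : {a | restrictVec w (v a) ≠ 0}.Finite := by
  obtain ⟨A₀, h, -⟩ := w.exists_functional_generic_eq_sum (formalSum hv MvPolynomial.X)
    (fun a => tensorToLim S (1 ⊗ₜ v a)) (map_killOutside_formalSum hv)
  exact A₀.finite_toSet.subset fun a ha => by_contra fun h' => ha (h a h')

/-- A functional on `lim 𝓜 i` is determined by its restriction to `lim M i`. -/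
theorem restrictVec_injective :
    Function.Injective (restrictVec : HomOver (limFunctor f) (base K) S → _) := by
  intro w₁ w₂ h
  rw [← sub_eq_zero]
  refine HomOver.ext_functional fun T _ _ φ x => ?_
  obtain ⟨v, hv, rfl⟩ := exists_eq_formalSum x
  have h0 : ∀ v, (w₁ - w₂).functional (AlgHom.id K S) (tensorToLim S (1 ⊗ₜ v)) = 0 := fun v => by
    rw [HomOver.functional_sub, sub_eq_zero]
    exact LinearMap.congr_fun h v
  obtain ⟨A₀, -, hA₀⟩ := (w₁ - w₂).exists_functional_generic_eq_sum
    (formalSum hv MvPolynomial.X) (fun a => tensorToLim S (1 ⊗ₜ v a)) (map_killOutside_formalSum hv)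
  -- the given element is the specialization `t_a ↦ b a` of the generic one
  have := (w₁ - w₂).functional_map (constHom K S _)
    (evalHom φ (Module.Basis.ofVectorSpace K T)) (formalSum hv MvPolynomial.X)
  rw [evalHom_comp_constHom, map_formalSum, hA₀] at this
  simp only [evalHom_X, h0, map_zero, mul_zero, Finset.sum_const_zero] at this
  exact this

theorem restrictVec_ofLinear_limProj (i : I) (ℓ : M i →ₗ[K] S) :
    restrictVec (ofLinear (limProj f i) ℓ) = ℓ ∘ₗ vecProj f i := by
  ext v
  rw [restrictVec_apply, functional_ofLinear, limProj_tensorToLim]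
  simp

/-! ### Countable and uncountable cofinality -/

theorem exists_comp_eq_of_ker_le {V W X : Type u} [AddCommGroup V] [Module K V] [AddCommGroup W]
    [Module K W] [AddCommGroup X] [Module K X] {p : V →ₗ[K] W} {g : V →ₗ[K] X}
    (h : LinearMap.ker p ≤ LinearMap.ker g) : ∃ ℓ : W →ₗ[K] X, ℓ ∘ₗ p = g := by
  obtain ⟨ℓ, hℓ⟩ := ((LinearMap.ker p).liftQ g h ∘ₗ
    p.quotKerEquivRange.symm.toLinearMap).exists_extend
  refine ⟨ℓ, LinearMap.ext fun v => ?_⟩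
  have := LinearMap.congr_fun hℓ ⟨p v, v, rfl⟩
  rw [LinearMap.comp_apply, LinearMap.comp_apply, LinearEquiv.coe_coe,
    p.quotKerEquivRange_symm_apply_image v ⟨v, rfl⟩] at this
  exact this

/-- If some sequence is cofinal in `I`, then every functional on the limit vanishes on the kernel
of some `lim M i → M i`, and therefore extends to `M i`. -/
theorem exists_eq_ofLinear_limProj (s : ℕ → I) (hs : ∀ i, ∃ n, i ≤ s n)
    (w : HomOver (limFunctor f) (base K) S) :
    ∃ (i : I) (ℓ : M i →ₗ[K] S), w = ofLinear (limProj f i) ℓ := by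
  suffices ∃ i, LinearMap.ker (vecProj f i) ≤ LinearMap.ker (restrictVec w) by
    obtain ⟨i, hi⟩ := this
    obtain ⟨ℓ, hℓ⟩ := exists_comp_eq_of_ker_le hi
    exact ⟨i, ℓ, restrictVec_injective (by rw [restrictVec_ofLinear_limProj, hℓ])⟩
  by_contra! hcon
  -- `partialSups s` replaces the cofinal sequence by a monotone one
  have hcon' : ∀ n : ℕ, ∃ v, vecProj f (partialSups s n) v = 0 ∧ restrictVec w v ≠ 0 := fun n => by
    obtain ⟨v, hv, hv'⟩ := SetLike.not_le_iff_exists.1 (hcon (partialSups s n))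
    exact ⟨v, hv, hv'⟩
  choose v hv hv' using hcon'
  have hsum : IsSummableFamily fun n : ULift.{u} ℕ => v n.down := by
    intro i
    obtain ⟨n, hn⟩ := hs i
    refine ((Set.finite_Iio n).preimage ULift.down_injective.injOn).subset fun m hm => ?_
    by_contra hnm
    refine hm ?_
    have hi : i ≤ partialSups s m.down :=
      hn.trans ((le_partialSups s n).trans ((partialSups s).monotone (not_lt.1 hnm)))
    rw [← map_vecProj hi, hv, map_zero]
  have hfin := finite_restrictVec_ne_zero w hsum
  rw [Set.eq_univ_of_forall (s := {a : ULift.{u} ℕ | restrictVec w (v a.down) ≠ 0})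
    fun a => hv' a.down] at hfin
  exact Set.infinite_univ hfin

/-- If no sequence is cofinal in `I`, then a summable family has only finitely many nonzero
members: indices witnessing that infinitely many members are nonzero would have an upper bound. -/
theorem IsSummableFamily.finite_ne_zero (hI : ∀ s : ℕ → I, ∃ i, ∀ n, s n ≤ i) {A : Type u}
    {v : A → vecLimit f} (hv : IsSummableFamily v) : {a | v a ≠ 0}.Finite := by
  by_contra hinf
  let a := Set.Infinite.natEmbedding _ hinf
  have hex : ∀ n, ∃ i, vecProj f i (v (a n)) ≠ 0 := fun n => by
    by_contra! h
    exact (a n).2 (vecLimit_ext fun i => by rw [h, map_zero])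
  choose s hs using hex
  obtain ⟨i, hi⟩ := hI s
  refine Set.infinite_of_injective_forall_mem (s := {a | vecProj f i (v a) ≠ 0})
    (f := fun n => (a n : A)) (Subtype.val_injective.comp a.injective) (fun n h0 => hs n ?_) (hv i)
  rw [← map_vecProj (hi n), h0, map_zero]

theorem tensorToLim_bijective (hI : ∀ s : ℕ → I, ∃ i, ∀ n, s n ≤ i) :
    Function.Bijective (tensorToLim (f := f) S) := by
  refine ⟨tensorToLim_injective, fun x => ?_⟩
  obtain ⟨v, hv, rfl⟩ := exists_eq_formalSum x
  refine ⟨_, (formalSum_eq_tensorToLim_sum hv _ (hv.finite_ne_zero hI).toFinset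
    fun a ha => ?_).symm⟩
  have : v a = 0 := by simpa using ha
  rw [this, TensorProduct.tmul_zero]

/-- The inverse of `tensorToLim`, as a morphism of functors. -/
noncomputable def limToTensor (hI : ∀ s : ℕ → I, ∃ i, ∀ n, s n ≤ i) :
    Hom (limFunctor f) (quasiCoherent K (vecLimit f)) where
  app S _ _ := (LinearEquiv.ofBijective (tensorToLim S) (tensorToLim_bijective hI)).symm.toLinearMap
  naturality {S T} _ _ _ _ g x := by
    obtain ⟨x, rfl⟩ := (tensorToLim_bijective hI).2 x
    rw [map_tensorToLim]
    have h : ∀ {S : Type u} [CommRing S] [Algebra K S] (y : S ⊗[K] vecLimit f),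
        (LinearEquiv.ofBijective (tensorToLim S) (tensorToLim_bijective hI)).symm
          (tensorToLim S y) = y := fun y => LinearEquiv.ofBijective_symm_apply_apply _ _
    exact (h _).trans (congrArg (g.toLinearMap.rTensor (vecLimit f)) (h x).symm)

theorem limToTensor_tensorToLim (hI : ∀ s : ℕ → I, ∃ i, ∀ n, s n ≤ i) (x : S ⊗[K] vecLimit f) :
    (limToTensor hI).toTensor S (tensorToLim S x) = x :=
  LinearEquiv.ofBijective_symm_apply_apply (f := tensorToLim S)
    (h := tensorToLim_bijective hI) x

theorem isReflexive_limFunctor_of_cofinal (s : ℕ → I) (hs : ∀ i, ∃ n, i ≤ s n) :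
    (limFunctor f).IsReflexive := by
  refine isReflexive_of_forall_exists_ofLinear (limProj f)
    (fun S _ _ x hx => limFunctor_ext fun i => by rw [hx, map_zero]) (fun S _ _ x hx => ?_)
    fun S _ _ w => exists_eq_ofLinear_limProj s hs w
  refine ⟨limMk f x fun i j h => ?_, fun i => rfl⟩
  rw [← sub_eq_zero]
  refine eq_zero_of_liftBaseChange_eq_zero fun ℓ => ?_
  have hpull : ofLinear (limProj f j) (ℓ ∘ₗ f h) = ofLinear (limProj f i) ℓ := by
    refine restrictVec_injective (LinearMap.ext fun v => ?_)
    simp only [restrictVec_ofLinear_limProj, LinearMap.comp_apply, map_vecProj]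
  rw [map_sub, sub_eq_zero, ← hx j i _ _ hpull]
  generalize x j = y
  induction y with
  | zero => simp
  | tmul s v => simp
  | add y z hy hz => simp only [map_add, hy, hz]

theorem isReflexive_limFunctor_of_bounded (hI : ∀ s : ℕ → I, ∃ i, ∀ n, s n ≤ i) :
    (limFunctor f).IsReflexive := by
  -- here the limit is itself quasi-coherent, so a single projection suffices
  refine isReflexive_of_forall_exists_ofLinear (J := PUnit) (fun _ => limToTensor hI)
    (fun S _ _ x hx => ?_) (fun S _ _ x _ => ?_) fun S _ _ w => ⟨⟨⟩, restrictVec w, ?_⟩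
  · obtain ⟨y, rfl⟩ := (tensorToLim_bijective hI).2 x
    have := hx ⟨⟩
    rw [limToTensor_tensorToLim] at this
    rw [this, map_zero]
  · exact ⟨tensorToLim S (x ⟨⟩), fun _ => limToTensor_tensorToLim hI _⟩
  · refine restrictVec_injective (LinearMap.ext fun v => ?_)
    rw [restrictVec_apply (ofLinear _ _), functional_ofLinear, limToTensor_tensorToLim]
    simp

end Limit

end FunctorOfModules

theorem mainTheorem3 (K : Type u) [Field K] (I : Type u) [LinearOrder I]
    (M : I → Type u) [∀ i, AddCommGroup (M i)] [∀ i, Module K (M i)]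
    (f : ∀ ⦃i j : I⦄, i ≤ j → M j →ₗ[K] M i)
    [InverseSystem (fun (i j : I) (h : i ≤ j) => (f h : M j → M i))] :
    (FunctorOfModules.inverseLimit (fun i => FunctorOfModules.quasiCoherent K (M i))
      (fun _ _ h => FunctorOfModules.quasiCoherentMap (f h))).IsReflexive := by
  by_cases hI : ∃ s : ℕ → I, ∀ i, ∃ n, i ≤ s n
  · obtain ⟨s, hs⟩ := hI
    exact FunctorOfModules.isReflexive_limFunctor_of_cofinal s hs
  · push Not at hI
    refine FunctorOfModules.isReflexive_limFunctor_of_bounded fun s => ?_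
    obtain ⟨i, hi⟩ := hI s
    exact ⟨i, fun n => (hi n).le⟩
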